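/- Let $p$ be a prime. Let $v_p$ denote the $p$-adic valuation on $\mathbb{Z}_p$, normalized by $v_p(p)=1$ and $v_p(0)=\infty$. Let $M_1,M_2,N_1,N_2$ be free $\mathbb{Z}_p$-modules of finite rank, each equipped with a $\mathbb{Z}_p$-linear endomorphism denoted $T$. For such a module $M$ write $\overline{M}=M\otimes_{\mathbb{Z}_p}\mathbb{F}_p$, regarded as an $\mathbb{F}_p[T]$-module. Let $\iota_1:\overline{N_1}\hookrightarrow\overline{M_1}$ and $\iota_2:\overline{N_2}\hookrightarrow\overline{M_2}$ be injective homomorphisms of $\mathbb{F}_p[T]$-modules (not assumed to lift to $\mathbb{Z}_p$), and put $$W_1=\overline{M_1}/\iota_1(\overline{N_1}),\qquad W_2=\overline{M_2}/\iota_2(\overline{N_2}).$$ For an $\mathbb{F}_p[T]$-module $W$ of finite length, let $W^{\mathrm{ss}}$ denote its semisimplification, that is, the direct sum of its composition factors counted with multiplicity. Then $W_1^{\mathrm{ss}}\cong W_2^{\mathrm{ss}}$ as $\mathbb{F}_p[T]$-modules if and only if for every integer $n\ge 0$ $$v_p\big(\operatorname{tr}(T^n|M_1)-\operatorname{tr}(T^n|N_1)-\operatorname{tr}(T^n|M_2)+\operatorname{tr}(T^n|N_2)\big)\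 \ge\ 1+v_p(n).$$ (For $n=0$ this condition says that $\operatorname{rank}M_1-\operatorname{rank}N_1=\operatorname{rank}M_2-\operatorname{rank}N_2$.) -/

import Mathlib

open scoped Polynomial TensorProduct

noncomputable section

namespace TraceCongruence

section Semisimplification

variable (R : Type*) [Ring R] (M : Type*) [AddCommGroup M] [Module R M]

/-- The direct sum of the successive quotients of a chain of submodules of `M`. -/
abbrev AssocGraded {R : Type*} [Ring R] {M : Type*} [AddCommGroup M] [Module R M]
    (s : CompositionSeries (Submodule R M)) : Type _ :=
  (i : Fin s.length) → (s i.succ) ⧸ (s i.castSucc).submoduleOf (s i.succ)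

/-- A chosen composition series `0 = s 0 < s 1 < ⋯ < s r = M` of a module of finite length. -/
def compositionSeries [IsNoetherian R M] [IsArtinian R M] :
    CompositionSeries (Submodule R M) :=
  (exists_compositionSeries_of_isNoetherian_isArtinian R M).choose

/-- The semisimplification of a module of finite length: the direct sum of its composition
factors, with multiplicity. By the Jordan–Hölder theorem its isomorphism class does not depend
on the chosen composition series. -/
abbrev Semisimplification [IsNoetherian R M] [IsArtinian R M] : Type _ :=
  AssocGraded (compositionSeries R M)

end Semisimplification

/-- `𝔽_p` as a `ℤ_p`-algebra, by reduction modulo `p`. -/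
instance zmodAlgebra (p : ℕ) [Fact p.Prime] : Algebra ℤ_[p] (ZMod p) :=
  (PadicInt.toZMod (p := p)).toAlgebra

/-- A module `V` over `K` with an operator `T`, as a module over `K[X]` with `X` acting as `T`. -/
abbrev PolyModule {K : Type*} [CommRing K] {V : Type*} [AddCommGroup V] [Module K V]
    (T : Module.End K V) : Type _ :=
  Module.AEval' T

/-- The `𝔽_p[T]`-module `M̄ = 𝔽_p ⊗ M`, for a `ℤ_p`-module `M` with an operator `T`: the variable
`X` of `(ZMod p)[X]` acts as `1 ⊗ T`. -/
abbrev Red (p : ℕ) [Fact p.Prime] {M : Type*} [AddCommGroup M] [Module ℤ_[p] M]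
    (T : Module.End ℤ_[p] M) : Type _ :=
  PolyModule (K := ZMod p) (V := ZMod p ⊗[ℤ_[p]] M) (T.baseChange (ZMod p))

/-- The reduction of a finitely generated module is finite-dimensional, hence Artinian. -/
instance isArtinian_red (p : ℕ) [Fact p.Prime] {M : Type*} [AddCommGroup M] [Module ℤ_[p] M]
    [Module.Finite ℤ_[p] M] (T : Module.End ℤ_[p] M) : IsArtinian (ZMod p)[X] (Red p T) :=
  isArtinian_of_tower (ZMod p) inferInstance

/-- The `p`-adic valuation on `ℤ_p`, with `v_p(p) = 1` and `v_p(0) = ∞`. -/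
def vp {p : ℕ} [Fact p.Prime] (x : ℤ_[p]) : WithTop ℤ :=
  Padic.addValuation (x : ℚ_[p])

end TraceCongruence

end

/-!
The semisimplification of a `K[X]`-module `V` of finite dimension over `K` is determined by the
characteristic polynomial `charX K V` of `X`: this polynomial is multiplicative in short exact
sequences, and a simple module is `K[X] ⧸ (charX)` with `charX` irreducible, so unique
factorization recovers the composition factors (`nonempty_semisimplification_equiv_iff`).
Writing `P₁, P₂, Q₁, Q₂` for the characteristic polynomials of `T` on `M₁, M₂, N₁, N₂`, the
semisimplifications of `W₁` and `W₂` are therefore isomorphic if and only if the monic polynomials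
`A = P₁ * Q₂` and `B = P₂ * Q₁` over `ℤ_[p]` agree modulo `p`.

For an operator `T`, the traces of the positive powers are, up to sign, the coefficients of the
logarithmic derivative of the reversed characteristic polynomial `det(1 - X T)`
(`reverse_charpoly_mul_mk_trace`). So the alternating sums of traces are, up to sign, the
coefficients of `X * u' / u` for the power series `u = A.reverse / B.reverse`, and for `n = 0` the
trace condition says that `A` and `B` have the same degree. What remains is a Dwork-type
congruence: `u ≡ 1` modulo `p` if and only if the `n`-th coefficient of `X * u' / u` is divisible
by `p * n` for all `n ≥ 1` (`dvd_coeff_logDeriv`, `C_dvd_sub_one_of_dvd_coeff_logDeriv`). Factoring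
`u` as an infinite product of binomials `1 + aₙ Xⁿ` reduces this to the case `u = 1 + a Xⁿ`, where
`X * u' / u = -∑ₖ n (-a)ᵏ Xⁿᵏ`: here `n * a` divisible by `p * n` means `p ∣ a`, and `p ∣ a` gives
`p * k ∣ aᵏ`, since `p * k ∣ pᵏ` in `ℤ_[p]`.

Logarithmic derivatives are encoded without division: a series `c` is the logarithmic derivative of
`u` when `u * c = u'`, so that the coefficient of `X ^ m` in `c` corresponds to `n = m + 1`.
-/

namespace TraceCongruence

open Polynomial

/-! ### Characteristic polynomials in short exact sequences -/

section Charpoly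

variable {R V : Type*} [CommRing R] [AddCommGroup V] [Module R V] [Module.Finite R V]

open Module.Basis in
theorem charpoly_eq_charpoly_mul_charpoly [Module.Free R V] (W : Submodule R V)
    [Module.Free R W] [Module.Finite R W] [Module.Free R (V ⧸ W)]
    (e : V →ₗ[R] V) (he : W ≤ W.comap e) :
    e.charpoly = (e.restrict he).charpoly * (W.mapQ W e he).charpoly := by
  let bW := Module.Free.chooseBasis R W
  let bQ := Module.Free.chooseBasis R (V ⧸ W)
  let b := sumQuot bW bQ
  have hblock : LinearMap.toMatrix b b e =
      Matrix.fromBlocks (LinearMap.toMatrix bW bW (e.restrict he))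
        (Matrix.of fun i l ↦ (b.repr (e (b (Sum.inr l)))) (Sum.inl i)) 0
        (LinearMap.toMatrix bQ bQ (W.mapQ W e he)) := by
    ext u v
    rcases u with i | j <;> rcases v with k | l
    · simp only [b, sumQuot_inl, Matrix.fromBlocks_apply₁₁, LinearMap.toMatrix_apply]
      apply sumQuot_repr_inl_of_mem
    · simp [LinearMap.toMatrix_apply, Matrix.fromBlocks_apply₁₂]
    · have : W.mkQ (e (bW k)) = 0 := by
        rw [← LinearMap.mem_ker, Submodule.ker_mkQ]
        exact he (Submodule.coe_mem (bW k))
      simp [LinearMap.toMatrix_apply, b, this]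
    · simp only [LinearMap.toMatrix_apply, sumQuot_repr_inr, Matrix.fromBlocks_apply₂₂, b]
      rw [← sumQuot_inr bW bQ l, W.mapQ_apply]
      simp
  rw [← LinearMap.charpoly_toMatrix e b, hblock, Matrix.charpoly_fromBlocks_zero₂₁,
    LinearMap.charpoly_toMatrix, LinearMap.charpoly_toMatrix]

end Charpoly

theorem charpoly_congr {R V W : Type*} [CommRing R] [AddCommGroup V] [Module R V]
    [Module.Free R V] [Module.Finite R V] [AddCommGroup W] [Module R W]
    [Module.Free R W] [Module.Finite R W] (e : V ≃ₗ[R] W) (f : Module.End R V)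
    (g : Module.End R W) (h : ∀ v, e (f v) = g (e v)) : f.charpoly = g.charpoly := by
  rw [← LinearEquiv.charpoly_conj e f]
  congr 1
  ext w
  simp [LinearEquiv.conj_apply, h]

theorem charpoly_eq_mul_of_exact {K U V W : Type*} [Field K] [AddCommGroup U] [Module K U]
    [AddCommGroup V] [Module K V] [Module.Finite K V] [AddCommGroup W] [Module K W]
    [Module.Finite K U] [Module.Finite K W]
    (i : U →ₗ[K] V) (q : V →ₗ[K] W) (hi : Function.Injective i) (hq : Function.Surjective q)
    (hiq : Function.Exact i q) (f : Module.End K U) (g : Module.End K V) (h : Module.End K W)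
    (hf : ∀ u, i (f u) = g (i u)) (hh : ∀ v, q (g v) = h (q v)) :
    g.charpoly = f.charpoly * h.charpoly := by
  have hker : LinearMap.ker q = LinearMap.range i := LinearMap.exact_iff.mp hiq
  have hle : LinearMap.ker q ≤ (LinearMap.ker q).comap g := fun v hv ↦ by
    rw [Submodule.mem_comap, LinearMap.mem_ker, hh, LinearMap.mem_ker.mp hv, map_zero]
  rw [charpoly_eq_charpoly_mul_charpoly (LinearMap.ker q) g hle]
  congr 1
  · symm
    refine charpoly_congr
      ((LinearEquiv.ofInjective i hi).trans (LinearEquiv.ofEq _ _ hker.symm)) _ _ fun u ↦ ?_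
    ext
    simp [hf]
  · refine charpoly_congr (q.quotKerEquivOfSurjective hq) _ _ fun v ↦ ?_
    obtain ⟨v, rfl⟩ := Submodule.mkQ_surjective _ v
    simp [hh]

/-! ### The characteristic polynomial of a module over `K[X]` -/

theorem nonempty_linearEquiv_quotient_annihilator {R M : Type*} [CommRing R] [AddCommGroup M]
    [Module R M] [IsSimpleModule R M] : Nonempty (M ≃ₗ[R] R ⧸ Module.annihilator R M) := by
  obtain ⟨I, -, ⟨e⟩⟩ := isSimpleModule_iff_quot_maximal.mp ‹IsSimpleModule R M›
  have hann : Module.annihilator R M = I := by rw [e.annihilator_eq, I.annihilator_quotient]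
  exact ⟨e.trans (Submodule.quotEquivOfEq _ _ hann.symm)⟩

section CharX

variable (K : Type*) [Field K]

/-- The characteristic polynomial of multiplication by `X` on a `K[X]`-module `V` of finite
dimension over `K`. -/
noncomputable def charX (V : Type*) [AddCommGroup V] [Module K V] [Module K[X] V]
    [IsScalarTower K K[X] V] [Module.Finite K V] : K[X] :=
  (Algebra.lsmul K K V (X : K[X])).charpoly

variable {K}
variable {U V W : Type*} [AddCommGroup U] [Module K U] [Module K[X] U]
    [IsScalarTower K K[X] U] [Module.Finite K U]
    [AddCommGroup V] [Module K V] [Module K[X] V]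
    [IsScalarTower K K[X] V] [Module.Finite K V]
    [AddCommGroup W] [Module K W] [Module K[X] W]
    [IsScalarTower K K[X] W] [Module.Finite K W]

instance finite_submodule (S : Submodule K[X] V) : Module.Finite K S :=
  inferInstanceAs (Module.Finite K (S.restrictScalars K))

theorem charX_monic : (charX K V).Monic := LinearMap.charpoly_monic _

theorem natDegree_charX : (charX K V).natDegree = Module.finrank K V :=
  LinearMap.charpoly_natDegree _

theorem charX_congr (e : V ≃ₗ[K[X]] W) : charX K V = charX K W :=
  charpoly_congr (e.restrictScalars K) _ _ fun v ↦ by simp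

theorem charX_eq_mul_of_exact (i : U →ₗ[K[X]] V) (q : V →ₗ[K[X]] W)
    (hi : Function.Injective i) (hq : Function.Surjective q) (hiq : Function.Exact i q) :
    charX K V = charX K U * charX K W :=
  charpoly_eq_mul_of_exact (i.restrictScalars K) (q.restrictScalars K) hi hq hiq _ _ _
    (fun u ↦ by simp) (fun v ↦ by simp)

theorem charX_eq_mul_quotient (S : Submodule K[X] V) :
    charX K V = charX K S * charX K (V ⧸ S) :=
  charX_eq_mul_of_exact S.subtype S.mkQ S.injective_subtype S.mkQ_surjective
    (LinearMap.exact_iff.mpr (by rw [S.ker_mkQ, S.range_subtype]))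

theorem charX_of_subsingleton [Subsingleton V] : charX K V = 1 := by
  refine charX_monic.natDegree_eq_zero.mp ?_
  rw [natDegree_charX, Module.finrank_zero_of_subsingleton]

theorem charX_prod : charX K (V × W) = charX K V * charX K W :=
  charX_eq_mul_of_exact (LinearMap.inl K[X] V W) (LinearMap.snd K[X] V W)
    LinearMap.inl_injective LinearMap.snd_surjective Function.Exact.inl_snd

theorem charX_pi {n : ℕ} (S : Fin n → Type*) [∀ i, AddCommGroup (S i)] [∀ i, Module K (S i)]
    [∀ i, Module K[X] (S i)] [∀ i, IsScalarTower K K[X] (S i)] [∀ i, Module.Finite K (S i)] :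
    charX K (∀ i, S i) = ∏ i, charX K (S i) := by
  induction n with
  | zero => simpa using charX_of_subsingleton
  | succ n ih =>
    rw [← charX_congr (Fin.consLinearEquiv K[X] S), charX_prod, ih, Fin.prod_univ_succ]

theorem aeval_charX_smul (v : V) : charX K V • v = 0 := by
  have h := LinearMap.aeval_self_charpoly (Algebra.lsmul K K V (X : K[X]))
  rw [aeval_algHom_apply, aeval_X_left_apply] at h
  exact LinearMap.congr_fun h v

/-- The annihilator of a simple `K[X]`-module is generated by the characteristic polynomial of
`X`, which it contains by Cayley–Hamilton: the two have the same codimension. -/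
theorem annihilator_eq_span_charX [IsSimpleModule K[X] V] :
    Module.annihilator K[X] V = Ideal.span {charX K V} := by
  obtain ⟨e⟩ := nonempty_linearEquiv_quotient_annihilator (R := K[X]) (M := V)
  obtain ⟨q, hq⟩ := (IsPrincipalIdealRing.principal (Module.annihilator K[X] V)).principal
  rw [← Ideal.span] at hq
  rw [hq] at e ⊢
  have hmem : charX K V ∈ Ideal.span {q} := by
    rw [← hq, Module.mem_annihilator]
    exact aeval_charX_smul
  have hdvd : q ∣ charX K V := Ideal.mem_span_singleton.mp hmem
  refine Ideal.span_singleton_eq_span_singleton.mpr ?_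
  refine associated_of_dvd_of_natDegree_le hdvd charX_monic.ne_zero ?_
  rw [natDegree_charX, (e.restrictScalars K).finrank_eq]
  exact (finrank_quotient_span_eq_natDegree (f := q)).le

theorem irreducible_charX [IsSimpleModule K[X] V] : Irreducible (charX K V) := by
  have h : (Module.annihilator K[X] V).IsMaximal := IsSimpleModule.annihilator_isMaximal
  rw [annihilator_eq_span_charX] at h
  exact ((Ideal.span_singleton_prime charX_monic.ne_zero).mp h.isPrime).irreducible

theorem nonempty_linearEquiv_of_charX_eq [IsSimpleModule K[X] V] [IsSimpleModule K[X] W]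
    (h : charX K V = charX K W) : Nonempty (V ≃ₗ[K[X]] W) := by
  obtain ⟨eV⟩ := nonempty_linearEquiv_quotient_annihilator (R := K[X]) (M := V)
  obtain ⟨eW⟩ := nonempty_linearEquiv_quotient_annihilator (R := K[X]) (M := W)
  exact ⟨eV.trans ((Submodule.quotEquivOfEq _ _ (by
    rw [annihilator_eq_span_charX, annihilator_eq_span_charX, h])).trans eW.symm)⟩

/-! ### Composition series -/

theorem charX_eq_prod_of_head_eq_bot (s : CompositionSeries (Submodule K[X] V))
    (h0 : s.head = ⊥) (h1 : s.last = ⊤) :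
    charX K V =
      ∏ i : Fin s.length, charX K ((s i.succ) ⧸ (s i.castSucc).submoduleOf (s i.succ)) := by
  have hstep (i : Fin s.length) : charX K (s i.succ) =
      charX K (s i.castSucc) *
        charX K ((s i.succ) ⧸ (s i.castSucc).submoduleOf (s i.succ)) := by
    rw [charX_eq_mul_quotient ((s i.castSucc).submoduleOf (s i.succ))]
    congr 1
    exact charX_congr (Submodule.submoduleOfEquivOfLe (s.lt_succ i).le)
  -- Telescoping along the series.
  have htel : ∀ (n : ℕ) (a : Fin (n + 1) → K[X]) (b : Fin n → K[X]),
      (∀ i, a i.succ = a i.castSucc * b i) → a (Fin.last n) = a 0 * ∏ i, b i := by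
    intro n a b hab
    induction n with
    | zero => simp
    | succ n ih =>
      rw [← Fin.succ_last, hab, Fin.prod_univ_castSucc, ← mul_assoc]
      congr 1
      exact ih (fun i ↦ a i.castSucc) (fun i ↦ b i.castSucc) fun i ↦ hab i.castSucc
  have hmain := htel s.length (fun i ↦ charX K (s i)) _ hstep
  have hbot : charX K (s 0) = 1 := by
    have : Subsingleton (s 0) := by
      rw [Submodule.subsingleton_iff_eq_bot]
      exact h0
    exact charX_of_subsingleton
  rw [hbot, one_mul] at hmain
  rw [← hmain]
  exact charX_congr ((LinearEquiv.ofTop (s.last) h1).symm)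

instance isSimpleModule_compositionFactor {R M : Type*} [Ring R] [AddCommGroup M] [Module R M]
    (s : CompositionSeries (Submodule R M)) (i : Fin s.length) :
    IsSimpleModule R ((s i.succ) ⧸ (s i.castSucc).submoduleOf (s i.succ)) :=
  (covBy_iff_quot_is_simple (s.lt_succ i).le).mp (s.step i)

theorem exists_equiv_of_multiset_map_eq {α β γ : Type*} [Fintype α] [Fintype β]
    {f : α → γ} {g : β → γ}
    (h : Multiset.map f Finset.univ.val = Multiset.map g Finset.univ.val) :
    ∃ e : α ≃ β, ∀ a, g (e a) = f a := by
  classical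
  have hcard (c : γ) : Nonempty ({a // f a = c} ≃ {b // g b = c}) := by
    refine ⟨Fintype.equivOfCardEq ?_⟩
    have := congrArg (Multiset.count c) h
    rw [Multiset.count_map, Multiset.count_map, ← Finset.filter_val, ← Finset.filter_val,
      Finset.card_val, Finset.card_val] at this
    simpa only [Fintype.card_subtype, eq_comm] using this
  exact ⟨Equiv.ofFiberEquiv fun c ↦ (hcard c).some, fun a ↦ Equiv.ofFiberEquiv_map _ a⟩

theorem exists_equiv_of_prod_eq {α β : Type*} [Fintype α] [Fintype β] {f : α → K[X]}
    {g : β → K[X]} (hf : ∀ a, (f a).Monic) (hf' : ∀ a, Irreducible (f a))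
    (hg : ∀ b, (g b).Monic) (hg' : ∀ b, Irreducible (g b)) (h : ∏ a, f a = ∏ b, g b) :
    ∃ e : α ≃ β, ∀ a, g (e a) = f a := by
  apply exists_equiv_of_multiset_map_eq
  have hrel : Multiset.Rel Associated (Multiset.map f Finset.univ.val)
      (Multiset.map g Finset.univ.val) :=
    UniqueFactorizationMonoid.factors_unique (by simpa using hf') (by simpa using hg')
      (by rw [Finset.prod_map_val, Finset.prod_map_val, h]; exact Associated.refl _)
  refine Multiset.rel_eq.mp (hrel.mono fun x hx y hy hxy ↦ ?_)
  obtain ⟨a, -, rfl⟩ := Multiset.mem_map.mp hx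
  obtain ⟨b, -, rfl⟩ := Multiset.mem_map.mp hy
  exact eq_of_monic_of_associated (hf a) (hg b) hxy

/-- Over `K[X]`, a module of finite dimension over `K` is determined up to semisimplification by
the characteristic polynomial of `X`, whose irreducible factors are those of the composition
factors. -/
theorem nonempty_semisimplification_equiv_iff [IsNoetherian K[X] V] [IsArtinian K[X] V]
    [IsNoetherian K[X] W] [IsArtinian K[X] W] :
    Nonempty (Semisimplification K[X] V ≃ₗ[K[X]] Semisimplification K[X] W) ↔
      charX K V = charX K W := by
  have hV := charX_eq_prod_of_head_eq_bot (compositionSeries K[X] V)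
    (exists_compositionSeries_of_isNoetherian_isArtinian K[X] V).choose_spec.1
    (exists_compositionSeries_of_isNoetherian_isArtinian K[X] V).choose_spec.2
  have hW := charX_eq_prod_of_head_eq_bot (compositionSeries K[X] W)
    (exists_compositionSeries_of_isNoetherian_isArtinian K[X] W).choose_spec.1
    (exists_compositionSeries_of_isNoetherian_isArtinian K[X] W).choose_spec.2
  constructor
  · rintro ⟨e⟩
    rw [hV, hW, ← charX_pi, ← charX_pi]
    exact charX_congr e
  · intro h
    rw [hV, hW] at h
    obtain ⟨e, he⟩ := exists_equiv_of_prod_eq (fun _ ↦ charX_monic)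
      (fun _ ↦ irreducible_charX) (fun _ ↦ charX_monic) (fun _ ↦ irreducible_charX) h
    exact ⟨(LinearEquiv.piCongrRight fun i ↦
      (nonempty_linearEquiv_of_charX_eq (he i).symm).some).trans
        (LinearEquiv.piCongrLeft K[X]
          (fun j ↦ (compositionSeries K[X] W j.succ) ⧸
            (compositionSeries K[X] W j.castSucc).submoduleOf
              (compositionSeries K[X] W j.succ)) e)⟩

end CharX

/-! ### Reduction modulo `p` -/

theorem charX_red (p : ℕ) [Fact p.Prime] {M : Type*} [AddCommGroup M] [Module ℤ_[p] M]
    [Module.Free ℤ_[p] M] [Module.Finite ℤ_[p] M] (T : Module.End ℤ_[p] M) :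
    charX (ZMod p) (Red p T) = T.charpoly.map (PadicInt.toZMod (p := p)) := by
  have h : T.charpoly.map (PadicInt.toZMod (p := p)) = (T.baseChange (ZMod p)).charpoly :=
    (LinearMap.charpoly_baseChange T (ZMod p)).symm
  rw [h]
  exact charpoly_congr (Module.AEval'.of (T.baseChange (ZMod p))).symm _ _
    fun v ↦ Module.AEval'.of_symm_X_smul _ v

/-! ### Traces of powers as power sums -/

theorem trace_pow_eq_sum_roots {K V : Type*} [Field K] [IsAlgClosed K] [AddCommGroup V]
    [Module K V] [Module.Finite K V] (f : Module.End K V) (n : ℕ) :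
    LinearMap.trace K V (f ^ n) = (f.charpoly.roots.map (· ^ n)).sum := by
  -- Both sides split off the same line and quotient once an eigenvector of `f` is chosen.
  suffices h : (f ^ n).charpoly.roots = f.charpoly.roots.map (· ^ n) by
    rw [Module.End.trace_eq_sum_roots_charpoly_of_splits (IsAlgClosed.splits _), h]
  induction hd : Module.finrank K V generalizing V with
  | zero =>
    have h (g : Module.End K V) : g.charpoly = 1 :=
      g.charpoly_monic.natDegree_eq_zero.mp (by rw [g.charpoly_natDegree, hd])
    simp [h]
  | succ d ih =>
    have : Nontrivial V := Module.nontrivial_of_finrank_pos (R := K) (by omega)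
    obtain ⟨c, hc⟩ := Module.End.exists_eigenvalue f
    obtain ⟨v, hv⟩ := hc.exists_hasEigenvector
    have hfv : f v = c • v := hv.apply_eq_smul
    have hfn : (f ^ n) v = c ^ n • v := hv.pow_apply n
    have hle (g : Module.End K V) (b : K) (hg : g v = b • v) : K ∙ v ≤ (K ∙ v).comap g := by
      rw [Submodule.span_singleton_le_iff_mem, Submodule.mem_comap, hg]
      exact Submodule.smul_mem _ _ (Submodule.mem_span_singleton_self v)
    have hline (g : Module.End K V) (b : K) (hg : g v = b • v) :
        (LinearMap.restrict (p := K ∙ v) (q := K ∙ v) g (hle g b hg)).charpoly = X - C b := by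
      -- A scalar is written as `0 - (-b) • 1` to read off its charpoly from that of `0`.
      have hs : LinearMap.restrict (p := K ∙ v) (q := K ∙ v) g (hle g b hg) =
          0 - (-b) • 1 := by
        ext ⟨w, hw⟩
        obtain ⟨a, rfl⟩ := Submodule.mem_span_singleton.mp hw
        simp [hg, smul_comm a b v]
      rw [hs, LinearMap.charpoly_sub_smul, LinearMap.charpoly_zero, finrank_span_singleton hv.2]
      simp [sub_eq_add_neg]
    have hquot : Module.finrank K (V ⧸ K ∙ v) = d := by
      have h1 := (K ∙ v).finrank_quotient_add_finrank
      rw [finrank_span_singleton hv.2, hd] at h1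
      omega
    have hpow : (K ∙ v).mapQ (K ∙ v) (f ^ n) (hle _ _ hfn) =
        (K ∙ v).mapQ (K ∙ v) f (hle _ _ hfv) ^ n :=
      Submodule.mapQ_pow _ (hle _ _ hfv) n _
    rw [charpoly_eq_charpoly_mul_charpoly (K ∙ v) _ (hle _ _ hfn),
      charpoly_eq_charpoly_mul_charpoly (K ∙ v) _ (hle _ _ hfv), hline _ _ hfn,
      hline _ _ hfv, hpow,
      roots_mul (mul_ne_zero (X_sub_C_ne_zero _) (LinearMap.charpoly_monic _).ne_zero),
      roots_mul (mul_ne_zero (X_sub_C_ne_zero _) (LinearMap.charpoly_monic _).ne_zero),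
      ih _ hquot, roots_X_sub_C, roots_X_sub_C]
    simp

theorem reverse_prod_mul_mk_powerSum {K : Type*} [Field K] (s : Multiset K) :
    (((s.map (X - C ·)).prod.reverse : K[X]) : PowerSeries K) *
        PowerSeries.mk (fun n ↦ -(s.map (· ^ (n + 1))).sum) =
      PowerSeries.derivative K ((s.map (X - C ·)).prod.reverse : K[X]) := by
  induction s using Multiset.induction_on with
  | empty =>
    have h : (1 : K[X]).reverse = 1 := reverse_C 1
    have h0 : PowerSeries.mk (fun _ : ℕ ↦ (0 : K)) = 0 := rfl
    simp [h, h0]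
  | cons a s ih =>
    have hlin : (X - C a : K[X]).reverse = 1 - C a * X := by
      rw [reverse, natDegree_X_sub_C, reflect_sub, reflect_C, pow_one]
      simp
    have hsplit : PowerSeries.mk (fun n ↦ -((a ::ₘ s).map (· ^ (n + 1))).sum) =
        PowerSeries.mk (fun n ↦ -a ^ (n + 1)) +
          PowerSeries.mk (fun n ↦ -(s.map (· ^ (n + 1))).sum) := by
      ext n
      simp [add_comm]
    have hone : (1 - PowerSeries.C a * PowerSeries.X : PowerSeries K) *
        PowerSeries.mk (fun n ↦ -a ^ (n + 1)) = -PowerSeries.C a := by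
      ext n
      rcases n with _ | n
      · simp [sub_mul, mul_assoc]
      · simp [sub_mul, mul_assoc, PowerSeries.coeff_succ_X_mul]
        ring
    have hder : PowerSeries.derivative K (1 - PowerSeries.C a * PowerSeries.X) =
        -PowerSeries.C a := by
      simp
    rw [Multiset.map_cons, Multiset.prod_cons, reverse_mul_of_domain, hlin, hsplit]
    push_cast
    rw [Derivation.leibniz, ← ih, hder, ← hone]
    simp only [smul_eq_mul]
    ring

/-- Newton's identities for the traces of the powers of `T`: minus the generating series
`∑ₙ tr(Tⁿ⁺¹) Xⁿ` is the logarithmic derivative of `det(1 - X T)`. -/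
theorem reverse_charpoly_mul_mk_trace {R : Type*} (K : Type*) {M : Type*} [CommRing R] [Field K]
    [IsAlgClosed K] [Algebra R K] [FaithfulSMul R K] [AddCommGroup M]
    [Module R M] [Module.Free R M] [Module.Finite R M] (T : Module.End R M) :
    (T.charpoly.reverse : PowerSeries R) *
        PowerSeries.mk (fun n ↦ -LinearMap.trace R M (T ^ (n + 1))) =
      PowerSeries.derivative R (T.charpoly.reverse : PowerSeries R) := by
  have hinj : Function.Injective (algebraMap R K) := FaithfulSMul.algebraMap_injective R K
  have hprod : (T.charpoly.map (algebraMap R K)) =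
      ((T.baseChange K).charpoly.roots.map (X - C ·)).prod := by
    rw [← LinearMap.charpoly_baseChange]
    exact (IsAlgClosed.splits _).eq_prod_roots_of_monic (LinearMap.charpoly_monic _)
  have hrev : (T.charpoly.map (algebraMap R K)).reverse =
      T.charpoly.reverse.map (algebraMap R K) := by
    rw [reverse, reverse, natDegree_map_eq_of_injective hinj, reflect_map]
  have h := reverse_prod_mul_mk_powerSum (T.baseChange K).charpoly.roots
  rw [← hprod, hrev] at h
  have htr (n : ℕ) : ((T.baseChange K).charpoly.roots.map (· ^ n)).sum =
      algebraMap R K (LinearMap.trace R M (T ^ n)) := by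
    rw [← trace_pow_eq_sum_roots, ← LinearMap.trace_baseChange, LinearMap.baseChange_pow]
  simp only [htr] at h
  have hmk : PowerSeries.map (algebraMap R K)
      (PowerSeries.mk fun n ↦ -LinearMap.trace R M (T ^ (n + 1))) =
      PowerSeries.mk fun n ↦ -algebraMap R K (LinearMap.trace R M (T ^ (n + 1))) := by
    ext n
    simp
  apply PowerSeries.map_injective (algebraMap R K) hinj
  rw [map_mul, hmk, PowerSeries.derivative_coe, ← Polynomial.polynomial_map_coe,
    ← Polynomial.polynomial_map_coe, h, PowerSeries.derivative_coe, derivative_map]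

end TraceCongruence

namespace TraceCongruence

/-! ### Divisibility in `ℤ_[p]` -/

section Padic

variable {p : ℕ} [hp : Fact p.Prime]

theorem vp_le_vp_iff_dvd {x y : ℤ_[p]} : vp y ≤ vp x ↔ y ∣ x := by
  constructor
  · intro h
    obtain hxy | ⟨z, rfl⟩ := ValuationRing.dvd_total y x
    · exact hxy
    · rcases eq_or_ne (x * z) 0 with h0 | h0
      · have hx : Padic.addValuation (x : ℚ_[p]) = ⊤ := by
          rw [vp, vp, h0, PadicInt.coe_zero, AddValuation.map_zero, top_le_iff] at h
          exact h
        have hx0 : x = 0 := by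
          rw [AddValuation.top_iff] at hx
          exact Subtype.ext hx
        simp [hx0]
      · have hx0 : x ≠ 0 := left_ne_zero_of_mul h0
        have hz0 : z ≠ 0 := right_ne_zero_of_mul h0
        rw [vp, vp, PadicInt.coe_mul, AddValuation.map_mul,
          Padic.addValuation.apply (fun h' ↦ hx0 (Subtype.ext h')),
          Padic.addValuation.apply (fun h' ↦ hz0 (Subtype.ext h')), ← WithTop.coe_add,
          WithTop.coe_le_coe, PadicInt.valuation_coe, PadicInt.valuation_coe] at h
        have hz : IsUnit z := by
          rw [PadicInt.isUnit_iff, PadicInt.norm_eq_zpow_neg_valuation hz0]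
          have : (z.valuation : ℤ) = 0 := by omega
          rw [this]
          simp
        exact hz.mul_right_dvd.mpr dvd_rfl
  · rintro ⟨z, rfl⟩
    rw [vp, vp, PadicInt.coe_mul, AddValuation.map_mul]
    refine le_add_of_nonneg_right ?_
    rcases eq_or_ne z 0 with rfl | hz
    · simp
    · rw [Padic.addValuation.apply (fun h' ↦ hz (Subtype.ext h')), PadicInt.valuation_coe]
      exact_mod_cast Nat.zero_le _

theorem one_add_vp_eq (n : ℕ) : 1 + vp (n : ℤ_[p]) = vp ((p : ℤ_[p]) * (n : ℤ_[p])) := by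
  have h : Padic.addValuation ((p : ℤ_[p]) : ℚ_[p]) = 1 := by
    rw [Padic.addValuation.apply fun h' ↦ (by exact_mod_cast hp.out.ne_zero : (p : ℤ_[p]) ≠ 0)
      (Subtype.ext h'), PadicInt.valuation_coe, PadicInt.valuation_p]
    rfl
  rw [vp, vp, PadicInt.coe_mul, AddValuation.map_mul, h]

theorem natCast_mul_natCast_dvd_pow {q : ℕ} (hq : q ≠ 0) :
    (p : ℤ_[p]) * (q : ℤ_[p]) ∣ (p : ℤ_[p]) ^ q := by
  obtain ⟨v, u, hu, hqu⟩ := Nat.exists_eq_pow_mul_and_not_dvd hq p hp.out.ne_one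
  have hunit : IsUnit (u : ℤ_[p]) := by
    by_contra h
    rw [PadicInt.not_isUnit_iff, ← Int.cast_natCast, PadicInt.norm_int_lt_one_iff_dvd] at h
    exact hu (by exact_mod_cast h)
  -- `v < p ^ v ≤ q`, where `v` is the valuation of `q`.
  have hv : v + 1 ≤ q := by
    have h1 : v < p ^ v := Nat.lt_pow_self hp.out.one_lt
    have h2 : p ^ v ≤ q := Nat.le_of_dvd (Nat.pos_of_ne_zero hq) ⟨u, hqu⟩
    omega
  have hq' : (q : ℤ_[p]) = (p : ℤ_[p]) ^ v * (u : ℤ_[p]) := by rw [hqu]; push_cast; rfl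
  rw [hq', ← mul_assoc, ← pow_succ', hunit.mul_right_dvd]
  exact pow_dvd_pow _ hv

end Padic

/-! ### Logarithmic derivatives of power series -/

open PowerSeries

section LogDeriv

variable {R : Type*} [CommRing R]

/-- The logarithmic derivative of `1 + a * X ^ n` for `n ≠ 0`, namely
`-∑ₖ n * (-a) ^ k * X ^ (n * k - 1)`, the sum being over `k ≥ 1`. -/
def logDerivBinomial (a : R) (n : ℕ) : R⟦X⟧ :=
  mk fun m ↦ if n ∣ m + 1 then -(n * (-a) ^ ((m + 1) / n)) else 0

theorem binomial_mul_logDerivBinomial (a : R) {n : ℕ} (hn : n ≠ 0) :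
    (1 + C a * X ^ n) * logDerivBinomial a n = d⁄dX R (1 + C a * X ^ n) := by
  ext m
  rw [add_mul, one_mul, mul_assoc, map_add, coeff_C_mul, coeff_X_pow_mul', coeff_derivative]
  simp only [logDerivBinomial, coeff_mk, map_add, coeff_C_mul, coeff_X_pow, coeff_one,
    Nat.succ_ne_zero, if_false, zero_add]
  by_cases hnm : n ≤ m
  · have h1 : m - n + 1 = m + 1 - n := by omega
    have h2 : n ∣ m + 1 - n ↔ n ∣ m + 1 := by
      rw [Nat.dvd_sub_iff_left (by omega) (dvd_refl n)]
    have h3 : m + 1 ≠ n := by omega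
    rw [if_pos hnm, if_neg h3, h1]
    simp only [h2]
    split_ifs with hd
    · have h4 : (m + 1) / n = (m + 1 - n) / n + 1 := by
        rw [← Nat.add_div_right _ (Nat.pos_of_ne_zero hn)]
        congr 1
        omega
      rw [h4, pow_succ]
      ring
    · simp
  · rw [if_neg hnm, mul_zero, add_zero]
    by_cases hm : m + 1 = n
    · subst hm
      simp [Nat.div_self]
      ring
    · have : ¬ n ∣ m + 1 := fun h ↦ by
        have := Nat.le_of_dvd (Nat.succ_pos m) h
        omega
      simp [hm, this]

/-- A power series `u = 1 + a Xⁿ + O(Xⁿ⁺¹)` is `1 + a Xⁿ` times a series `v = 1 + O(Xⁿ⁺¹)`, and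
the logarithmic derivatives add up. -/
theorem exists_eq_binomial_mul [IsDomain R] {u c : R⟦X⟧} (huc : u * c = d⁄dX R u) {n : ℕ}
    (hn : n ≠ 0) (hu : X ^ n ∣ u - 1) :
    ∃ v : R⟦X⟧, u = (1 + C (coeff n u) * X ^ n) * v ∧
      v * (c - logDerivBinomial (coeff n u) n) = d⁄dX R v ∧ X ^ (n + 1) ∣ v - 1 := by
  set a := coeff n u
  set w : R⟦X⟧ := 1 + C a * X ^ n with hw
  have hw0 : constantCoeff w = 1 := by simp [hw, hn]
  have hwne : w ≠ 0 := fun h ↦ by simp [h] at hw0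
  have hwinv : w * invOfUnit w 1 = 1 := mul_invOfUnit w 1 (by simp [hw0])
  refine ⟨invOfUnit w 1 * u, ?_, ?_, ?_⟩
  · rw [← mul_assoc, hwinv, one_mul]
  · set v := invOfUnit w 1 * u with hv
    have huv : u = w * v := by rw [hv, ← mul_assoc, hwinv, one_mul]
    have hb := binomial_mul_logDerivBinomial a hn
    rw [← hw] at hb
    rw [huv, Derivation.leibniz] at huc
    simp only [smul_eq_mul] at huc
    apply mul_left_cancel₀ hwne
    linear_combination huc - v * hb
  · have h1 : invOfUnit w 1 * u - 1 = invOfUnit w 1 * (u - w) := by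
      linear_combination hwinv
    rw [h1]
    refine Dvd.dvd.mul_left (X_pow_dvd_iff.mpr fun m hm ↦ ?_) _
    rcases Nat.lt_succ_iff_lt_or_eq.mp hm with hm | rfl
    · have := X_pow_dvd_iff.mp hu m hm
      simp [hw, coeff_X_pow, hm.ne] at this ⊢
      exact this
    · simp [hw, coeff_X_pow, a, coeff_one, hn]

/-- If `u = 1 + O(X ^ (n + 1))`, then `u' / u` agrees with `u'` in degrees up to `n`. -/
theorem coeff_logDeriv {u c : R⟦X⟧} (huc : u * c = d⁄dX R u) {n m : ℕ}
    (hu : X ^ (n + 1) ∣ u - 1) (hm : m ≤ n) : coeff m c = coeff (m + 1) u * (m + 1) := by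
  obtain ⟨g, hg⟩ := hu
  rw [← coeff_derivative, ← huc, show u * c = c + X ^ (n + 1) * (g * c) by
    linear_combination c * hg, map_add, coeff_X_pow_mul', if_neg (by omega), add_zero]

end LogDeriv

section Congruence

variable {p : ℕ} [hp : Fact p.Prime]

theorem dvd_coeff_logDerivBinomial {a : ℤ_[p]} (ha : (p : ℤ_[p]) ∣ a) {n : ℕ} (m : ℕ) :
    (p : ℤ_[p]) * (m + 1 : ℕ) ∣ coeff m (logDerivBinomial a n) := by
  rw [logDerivBinomial, coeff_mk]
  split_ifs with h
  · obtain ⟨q, hq⟩ := h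
    have hn : n ≠ 0 := by rintro rfl; simp at hq
    have hq0 : q ≠ 0 := by rintro rfl; simp at hq
    rw [hq, Nat.mul_div_cancel_left _ (Nat.pos_of_ne_zero hn), dvd_neg]
    push_cast
    rw [mul_left_comm]
    refine mul_dvd_mul_left _ ((natCast_mul_natCast_dvd_pow hq0).trans ?_)
    exact pow_dvd_pow_of_dvd (by rwa [dvd_neg]) q
  · exact dvd_zero _

theorem C_dvd_iff_forall_dvd_coeff {R : Type*} [CommRing R] {a : R} {f : R⟦X⟧} :
    C a ∣ f ↔ ∀ n, a ∣ coeff n f := by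
  constructor
  · rintro ⟨g, rfl⟩ n
    rw [coeff_C_mul]
    exact dvd_mul_right _ _
  · intro h
    choose g hg using h
    exact ⟨mk g, by ext n; rw [coeff_C_mul, coeff_mk, hg]⟩

/-- If `u ≡ 1` modulo `p`, then the `m`-th coefficient of `X * u' / u` is divisible by `p * m`.
The binomials `1 + a Xⁿ` with `p ∣ a` satisfy this, and dividing by them one after the other
brings `u` arbitrarily close to `1`. -/
theorem dvd_coeff_logDeriv {u c : ℤ_[p]⟦X⟧} (huc : u * c = d⁄dX ℤ_[p] u)
    (hu0 : constantCoeff u = 1) (hpu : C (p : ℤ_[p]) ∣ u - 1) (m : ℕ) :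
    (p : ℤ_[p]) * (m + 1 : ℕ) ∣ coeff m c := by
  -- Induction on the number `k` of binomials still to be divided out before degree `m + 1`.
  have key (k : ℕ) : ∀ (n : ℕ) (u c : ℤ_[p]⟦X⟧), u * c = d⁄dX ℤ_[p] u →
      C (p : ℤ_[p]) ∣ u - 1 → X ^ (n + 1) ∣ u - 1 → m + 1 ≤ n + k →
      (p : ℤ_[p]) * (m + 1 : ℕ) ∣ coeff m c := by
    induction k with
    | zero =>
      intro n u c huc _ hX hm
      have h := X_pow_dvd_iff.mp hX (m + 1) (by omega)
      rw [map_sub, coeff_one, if_neg m.succ_ne_zero, sub_zero] at h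
      rw [coeff_logDeriv huc hX (by omega), h, zero_mul]
      exact dvd_zero _
    | succ k ih =>
      intro n u c huc hpu hX hm
      obtain ⟨v, huv, hv, hXv⟩ := exists_eq_binomial_mul (n := n + 1) huc (Nat.succ_ne_zero n) hX
      have ha : (p : ℤ_[p]) ∣ coeff (n + 1) u := by
        have h := C_dvd_iff_forall_dvd_coeff.mp hpu (n + 1)
        rwa [map_sub, coeff_one, if_neg n.succ_ne_zero, sub_zero] at h
      have hpv : C (p : ℤ_[p]) ∣ v - 1 := by
        have h : v - 1 = (u - 1) - C (coeff (n + 1) u) * (X ^ (n + 1) * v) := by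
          linear_combination -huv
        rw [h]
        exact dvd_sub hpu ((map_dvd C ha).mul_right _)
      have h := (ih (n + 1) v _ hv hpv hXv (by omega)).add
        (dvd_coeff_logDerivBinomial ha (n := n + 1) m)
      rwa [map_sub, sub_add_cancel] at h
  refine key (m + 1) 0 u c huc hpu ?_ (by omega)
  rw [zero_add, pow_one, X_dvd_iff, map_sub, hu0, map_one, sub_self]

/-- Converse of `dvd_coeff_logDeriv`: the leading coefficient `a` of `u - 1 = a Xⁿ + ⋯` is
read off from the coefficient `n * a` of `X * u' / u`, so `p ∣ a`, and `1 + a Xⁿ` can be divided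
out. -/
theorem C_dvd_sub_one_of_dvd_coeff_logDeriv {u c : ℤ_[p]⟦X⟧} (huc : u * c = d⁄dX ℤ_[p] u)
    (hu0 : constantCoeff u = 1)
    (hc : ∀ m, (p : ℤ_[p]) * (m + 1 : ℕ) ∣ coeff m c) : C (p : ℤ_[p]) ∣ u - 1 := by
  rw [C_dvd_iff_forall_dvd_coeff]
  intro m
  have key (k : ℕ) : ∀ (n : ℕ) (u c : ℤ_[p]⟦X⟧), u * c = d⁄dX ℤ_[p] u →
      (∀ m, (p : ℤ_[p]) * (m + 1 : ℕ) ∣ coeff m c) → X ^ (n + 1) ∣ u - 1 → m ≤ n + k →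
      (p : ℤ_[p]) ∣ coeff m (u - 1) := by
    induction k with
    | zero =>
      intro n u c _ _ hX hm
      rw [X_pow_dvd_iff.mp hX m (by omega)]
      exact dvd_zero _
    | succ k ih =>
      intro n u c huc hc hX hm
      obtain ⟨v, huv, hv, hXv⟩ := exists_eq_binomial_mul (n := n + 1) huc (Nat.succ_ne_zero n) hX
      have ha : (p : ℤ_[p]) ∣ coeff (n + 1) u := by
        have h := hc n
        rw [coeff_logDeriv huc hX le_rfl] at h
        push_cast at h
        exact (mul_dvd_mul_iff_right (by exact_mod_cast n.succ_ne_zero)).mp h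
      have h : u - 1 = (v - 1) + C (coeff (n + 1) u) * (X ^ (n + 1) * v) := by
        linear_combination huv
      rw [h, map_add, coeff_C_mul]
      refine dvd_add (ih (n + 1) v _ hv (fun j ↦ ?_) hXv (by omega)) (ha.mul_right _)
      rw [map_sub]
      exact dvd_sub (hc j) (dvd_coeff_logDerivBinomial ha j)
  refine key m 0 u c huc hc ?_ (by omega)
  rw [zero_add, pow_one, X_dvd_iff, map_sub, hu0, map_one, sub_self]

end Congruence

end TraceCongruence

namespace TraceCongruence

open Polynomial

/-! ### Congruences between polynomials and between power sums -/

section Main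

variable {p : ℕ} [hp : Fact p.Prime]

theorem toZMod_eq_toZMod_iff {x y : ℤ_[p]} :
    PadicInt.toZMod x = PadicInt.toZMod y ↔ (p : ℤ_[p]) ∣ x - y := by
  rw [← sub_eq_zero, ← map_sub, ← RingHom.mem_ker, PadicInt.ker_toZMod,
    PadicInt.maximalIdeal_eq_span_p, Ideal.mem_span_singleton]

theorem map_toZMod_eq_iff_C_dvd_reverse_sub {A B : ℤ_[p][X]}
    (hdeg : A.natDegree = B.natDegree) :
    A.map (PadicInt.toZMod (p := p)) = B.map (PadicInt.toZMod (p := p)) ↔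
      PowerSeries.C (p : ℤ_[p]) ∣ ((A.reverse : ℤ_[p][X]) : PowerSeries ℤ_[p]) - B.reverse := by
  rw [C_dvd_iff_forall_dvd_coeff, Polynomial.ext_iff]
  simp only [map_sub, coeff_coe, coeff_map, toZMod_eq_toZMod_iff, coeff_reverse, hdeg]
  exact ⟨fun h n ↦ h _, fun h n ↦ by simpa using h (revAt B.natDegree n)⟩

/-- Monic polynomials of the same degree over `ℤ_[p]` agree modulo `p` if and only if, for all
`n ≥ 1`, the `n`-th power sums of their roots agree modulo `p * n`; the power sums enter, up to
sign, as the coefficients of the logarithmic derivatives `a` and `b`. -/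
theorem map_toZMod_eq_iff_dvd_coeff {A B : ℤ_[p][X]} (hA : A.Monic) (hB : B.Monic)
    (hdeg : A.natDegree = B.natDegree) {a b : PowerSeries ℤ_[p]}
    (ha : (A.reverse : PowerSeries ℤ_[p]) * a =
      PowerSeries.derivative ℤ_[p] (A.reverse : PowerSeries ℤ_[p]))
    (hb : (B.reverse : PowerSeries ℤ_[p]) * b =
      PowerSeries.derivative ℤ_[p] (B.reverse : PowerSeries ℤ_[p])) :
    A.map (PadicInt.toZMod (p := p)) = B.map (PadicInt.toZMod (p := p)) ↔
      ∀ m : ℕ, (p : ℤ_[p]) * (m + 1 : ℕ) ∣ PowerSeries.coeff m (a - b) := by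
  rw [map_toZMod_eq_iff_C_dvd_reverse_sub hdeg]
  have hconst {P : ℤ_[p][X]} (hP : P.Monic) :
      PowerSeries.constantCoeff (P.reverse : PowerSeries ℤ_[p]) = 1 := by
    rw [Polynomial.constantCoeff_coe, coeff_zero_reverse, hP.leadingCoeff]
  have hA0 := hconst hA
  have hB0 := hconst hB
  set f : PowerSeries ℤ_[p] := (A.reverse : PowerSeries ℤ_[p])
  set g : PowerSeries ℤ_[p] := (B.reverse : PowerSeries ℤ_[p])
  have hg : g ≠ 0 := fun h ↦ by simp [h] at hB0
  set i := PowerSeries.invOfUnit g 1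
  have hgi : g * i = 1 := PowerSeries.mul_invOfUnit g 1 (by simp [hB0])
  obtain ⟨u, hu⟩ : ∃ u, u = i * f := ⟨_, rfl⟩
  have hfu : f = g * u := by rw [hu, ← mul_assoc, hgi, one_mul]
  have hu0 : PowerSeries.constantCoeff u = 1 := by
    have h := congrArg PowerSeries.constantCoeff hfu
    rwa [map_mul, hA0, hB0, one_mul, eq_comm] at h
  have hlog : u * (a - b) = PowerSeries.derivative ℤ_[p] u := by
    rw [hfu, Derivation.leibniz] at ha
    simp only [smul_eq_mul] at ha
    apply mul_left_cancel₀ hg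
    linear_combination ha - u * hb
  have hiff : PowerSeries.C (p : ℤ_[p]) ∣ f - g ↔ PowerSeries.C (p : ℤ_[p]) ∣ u - 1 := by
    constructor
    · intro h
      rw [show u - 1 = i * (f - g) by linear_combination hu + hgi]
      exact h.mul_left _
    · intro h
      rw [show f - g = g * (u - 1) by linear_combination hfu]
      exact h.mul_left _
  rw [hiff]
  exact ⟨dvd_coeff_logDeriv hlog hu0, C_dvd_sub_one_of_dvd_coeff_logDeriv hlog hu0⟩

/-- The exact sequence `0 → N̄ → M̄ → M̄ ⧸ N̄ → 0` on characteristic polynomials. -/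
theorem charpoly_map_eq_mul_charX {M N : Type*}
    [AddCommGroup M] [Module ℤ_[p] M] [Module.Free ℤ_[p] M] [Module.Finite ℤ_[p] M]
    [AddCommGroup N] [Module ℤ_[p] N] [Module.Free ℤ_[p] N] [Module.Finite ℤ_[p] N]
    (TM : Module.End ℤ_[p] M) (TN : Module.End ℤ_[p] N)
    (ι : Red p TN →ₗ[(ZMod p)[X]] Red p TM) (hι : Function.Injective ι) :
    TM.charpoly.map (PadicInt.toZMod (p := p)) =
      TN.charpoly.map (PadicInt.toZMod (p := p)) *
        charX (ZMod p) (Red p TM ⧸ LinearMap.range ι) := by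
  rw [← charX_red, ← charX_red]
  exact charX_eq_mul_of_exact ι (LinearMap.range ι).mkQ hι (Submodule.mkQ_surjective _)
    (LinearMap.exact_iff.mpr (Submodule.ker_mkQ _))

/-- Additivity of logarithmic derivatives, for the reverse of a product. -/
theorem reverse_mul_mul_add {R : Type*} [CommRing R] [IsDomain R] {P Q : R[X]}
    {a b : PowerSeries R}
    (ha : (P.reverse : PowerSeries R) * a = PowerSeries.derivative R (P.reverse : PowerSeries R))
    (hb : (Q.reverse : PowerSeries R) * b =
      PowerSeries.derivative R (Q.reverse : PowerSeries R)) :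
    ((P * Q).reverse : PowerSeries R) * (a + b) =
      PowerSeries.derivative R ((P * Q).reverse : PowerSeries R) := by
  rw [reverse_mul_of_domain, Polynomial.coe_mul, Derivation.leibniz, ← ha, ← hb]
  simp only [smul_eq_mul]
  ring

end Main

end TraceCongruence

theorem corollary1p4 (p : ℕ) [Fact p.Prime]
    {M₁ M₂ N₁ N₂ : Type*}
    [AddCommGroup M₁] [Module ℤ_[p] M₁] [Module.Free ℤ_[p] M₁] [Module.Finite ℤ_[p] M₁]
    [AddCommGroup M₂] [Module ℤ_[p] M₂] [Module.Free ℤ_[p] M₂] [Module.Finite ℤ_[p] M₂]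
    [AddCommGroup N₁] [Module ℤ_[p] N₁] [Module.Free ℤ_[p] N₁] [Module.Finite ℤ_[p] N₁]
    [AddCommGroup N₂] [Module ℤ_[p] N₂] [Module.Free ℤ_[p] N₂] [Module.Finite ℤ_[p] N₂]
    (TM₁ : Module.End ℤ_[p] M₁) (TM₂ : Module.End ℤ_[p] M₂)
    (TN₁ : Module.End ℤ_[p] N₁) (TN₂ : Module.End ℤ_[p] N₂)
    (ι₁ : TraceCongruence.Red p TN₁ →ₗ[(ZMod p)[X]] TraceCongruence.Red p TM₁)
    (hι₁ : Function.Injective ι₁)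
    (ι₂ : TraceCongruence.Red p TN₂ →ₗ[(ZMod p)[X]] TraceCongruence.Red p TM₂)
    (hι₂ : Function.Injective ι₂) :
    Nonempty
        (TraceCongruence.Semisimplification (ZMod p)[X]
            (TraceCongruence.Red p TM₁ ⧸ LinearMap.range ι₁) ≃ₗ[(ZMod p)[X]]
          TraceCongruence.Semisimplification (ZMod p)[X]
            (TraceCongruence.Red p TM₂ ⧸ LinearMap.range ι₂)) ↔
      ∀ n : ℕ,
        TraceCongruence.vp
            (LinearMap.trace ℤ_[p] M₁ (TM₁ ^ n) - LinearMap.trace ℤ_[p] N₁ (TN₁ ^ n)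
              - LinearMap.trace ℤ_[p] M₂ (TM₂ ^ n) + LinearMap.trace ℤ_[p] N₂ (TN₂ ^ n)) ≥
          1 + TraceCongruence.vp (n : ℤ_[p]) := by
  open TraceCongruence in
  have hfaithful : FaithfulSMul ℤ_[p] (AlgebraicClosure ℚ_[p]) := by
    rw [faithfulSMul_iff_algebraMap_injective, IsScalarTower.algebraMap_eq ℤ_[p] ℚ_[p]]
    exact (algebraMap ℚ_[p] (AlgebraicClosure ℚ_[p])).injective.comp
      (IsFractionRing.injective ℤ_[p] ℚ_[p])
  rw [nonempty_semisimplification_equiv_iff (K := ZMod p)]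
  have hM₁ := TM₁.charpoly_monic
  have hM₂ := TM₂.charpoly_monic
  have hN₁ := TN₁.charpoly_monic
  have hN₂ := TN₂.charpoly_monic
  have h₁ := charpoly_map_eq_mul_charX TM₁ TN₁ ι₁ hι₁
  have h₂ := charpoly_map_eq_mul_charX TM₂ TN₂ ι₂ hι₂
  have hcross : charX (ZMod p) (Red p TM₁ ⧸ LinearMap.range ι₁) =
        charX (ZMod p) (Red p TM₂ ⧸ LinearMap.range ι₂) ↔
      (TM₁.charpoly * TN₂.charpoly).map (PadicInt.toZMod (p := p)) =
        (TM₂.charpoly * TN₁.charpoly).map (PadicInt.toZMod (p := p)) := by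
    have hne := mul_ne_zero (hN₁.map (PadicInt.toZMod (p := p))).ne_zero
      (hN₂.map (PadicInt.toZMod (p := p))).ne_zero
    rw [Polynomial.map_mul, Polynomial.map_mul, h₁, h₂, mul_right_comm, mul_right_comm _ _
      (TN₁.charpoly.map _), mul_comm (TN₂.charpoly.map _) (TN₁.charpoly.map _)]
    exact ⟨fun h ↦ by rw [h], fun h ↦ mul_left_cancel₀ hne h⟩
  have hdegA : (TM₁.charpoly * TN₂.charpoly).natDegree =
      Module.finrank ℤ_[p] M₁ + Module.finrank ℤ_[p] N₂ := by
    rw [hM₁.natDegree_mul hN₂, TM₁.charpoly_natDegree, TN₂.charpoly_natDegree]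
  have hdegB : (TM₂.charpoly * TN₁.charpoly).natDegree =
      Module.finrank ℤ_[p] M₂ + Module.finrank ℤ_[p] N₁ := by
    rw [hM₂.natDegree_mul hN₁, TM₂.charpoly_natDegree, TN₁.charpoly_natDegree]
  have hmain (hdeg : (TM₁.charpoly * TN₂.charpoly).natDegree =
      (TM₂.charpoly * TN₁.charpoly).natDegree) :=
    map_toZMod_eq_iff_dvd_coeff (hM₁.mul hN₂) (hM₂.mul hN₁) hdeg
      (reverse_mul_mul_add (reverse_charpoly_mul_mk_trace (AlgebraicClosure ℚ_[p]) TM₁)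
        (reverse_charpoly_mul_mk_trace (AlgebraicClosure ℚ_[p]) TN₂))
      (reverse_mul_mul_add (reverse_charpoly_mul_mk_trace (AlgebraicClosure ℚ_[p]) TM₂)
        (reverse_charpoly_mul_mk_trace (AlgebraicClosure ℚ_[p]) TN₁))
  -- The condition at `n = 0` is divisibility by `p * 0`, that is, equality of ranks.
  have hrank : (p : ℤ_[p]) * ((0 : ℕ) : ℤ_[p]) ∣
      (LinearMap.trace ℤ_[p] M₁ (TM₁ ^ 0) - LinearMap.trace ℤ_[p] N₁ (TN₁ ^ 0)
        - LinearMap.trace ℤ_[p] M₂ (TM₂ ^ 0) + LinearMap.trace ℤ_[p] N₂ (TN₂ ^ 0)) ↔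
      (TM₁.charpoly * TN₂.charpoly).natDegree =
        (TM₂.charpoly * TN₁.charpoly).natDegree := by
    rw [hdegA, hdegB, Nat.cast_zero, mul_zero, zero_dvd_iff]
    simp only [pow_zero, LinearMap.trace_one]
    rw [← Nat.cast_inj (R := ℤ_[p]), ← sub_eq_zero (b := ((_ : ℕ) : ℤ_[p]))]
    push_cast
    ring_nf
  have hcoeff (n : ℕ) : PowerSeries.coeff n
      (PowerSeries.mk (fun n ↦ -LinearMap.trace ℤ_[p] M₁ (TM₁ ^ (n + 1))) +
        PowerSeries.mk (fun n ↦ -LinearMap.trace ℤ_[p] N₂ (TN₂ ^ (n + 1))) -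
        (PowerSeries.mk (fun n ↦ -LinearMap.trace ℤ_[p] M₂ (TM₂ ^ (n + 1))) +
        PowerSeries.mk (fun n ↦ -LinearMap.trace ℤ_[p] N₁ (TN₁ ^ (n + 1))))) =
      -(LinearMap.trace ℤ_[p] M₁ (TM₁ ^ (n + 1)) - LinearMap.trace ℤ_[p] N₁ (TN₁ ^ (n + 1))
        - LinearMap.trace ℤ_[p] M₂ (TM₂ ^ (n + 1))
        + LinearMap.trace ℤ_[p] N₂ (TN₂ ^ (n + 1))) := by
    simp only [map_sub, map_add, PowerSeries.coeff_mk]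
    ring
  simp only [hcoeff, dvd_neg] at hmain
  simp only [ge_iff_le, one_add_vp_eq, vp_le_vp_iff_dvd]
  rw [hcross]
  constructor
  · intro h
    have hdeg : (TM₁.charpoly * TN₂.charpoly).natDegree =
        (TM₂.charpoly * TN₁.charpoly).natDegree := by
      rw [← (hM₁.mul hN₂).natDegree_map (PadicInt.toZMod (p := p)), h,
        (hM₂.mul hN₁).natDegree_map]
    rintro (_ | n)
    · exact hrank.mpr hdeg
    · exact (hmain hdeg).mp h n
  · intro h
    exact (hmain (hrank.mp (h 0))).mpr fun n ↦ h (n + 1)
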